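/- **Proposition 5.8 (2-dim partition).** Let $\Gamma$ be a finite, undirected, connected graph without loops or multiple edges, with vertex set $X$, path-length distance $\partial$ and diameter $d\ge 3$. Write $\Gamma_i(x)=\{y\in X:\partial(x,y)=i\}$ and $\Gamma(x)=\Gamma_1(x)$. Assume that $\Gamma$ is distance-regular, i.e. for $\partial(x,y)=h$ the number $p^h_{i,j}=|\Gamma_i(x)\cap\Gamma_j(y)|$ depends only on $h,i,j$. Put $a_i=p^i_{1,i}$, $b_i=p^i_{1,i+1}$, $c_i=p^i_{1,i-1}$, with $b_d=0$, $c_0=0$, and $k=b_0$. Let $C\subseteq X$ be a Delsarte clique, i.e. a nonempty set of pairwise adjacent vertices with $|C|=1-k/\theta$, where $\theta$ is the least eigenvalue of the adjacency matrix of $\Gamma$. Fix $x\in C$. Let $C_i=\{y\in X:\min_{z\in C}\partial(y,z)=i\}$ and $C_{-1}=\emptyset$. For $0\le i\le d-1$ let $$C_i^-=C_i\cap\Gamma_i(x),\qquad C_i^+=C_i\cap\Gamma_{i+1}(x),$$ and let $C^\pm_{-1}=C^\pm_d=\emptyset$. Then the $2d$ sets $C_i^-,C_i^+$ $(0\le i\le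 d-1)$ are nonempty, mutually disjoint, and their union is $X$. This partition is equitable: for any two cells $P,Q$, all vertices of $P$ have the same number of neighbours in $Q$. More precisely, for $0\le i\le d-1$ and $z\in C_i$ the numbers $$\widetilde c_i=|\Gamma(z)\cap C_{i-1}|,\qquad \widetilde a_i=|\Gamma(z)\cap C_i|,\qquad \widetilde b_i=|\Gamma(z)\cap C_{i+1}|$$ do not depend on the choice of $z\in C_i$, and the following hold for $0\le i\le d-1$. 1. The cardinalities are $$|C_i^-|=\frac{\widetilde b_0\widetilde b_1\cdots\widetilde b_{i-1}}{c_1c_2\cdots c_i},\qquad |C_i^+|=\frac{b_1b_2\cdots b_i}{\widetilde c_1\widetilde c_2\cdots\widetilde c_i}\,(|C|-1).$$ 2. Each $z\in C_i^-$ is adjacent to exactly $c_i$ vertices in $C_{i-1}^-$ and $\widetilde c_i-c_i$ vertices in $C_{i-1}^+$ (these two when $i\ge1$), $a_i-\widetilde c_i+c_i$ vertices in $C_i^-$, $b_i-\widetilde b_i$ vertices in $C_i^+$, $\widetilde b_i$ vertices in $C_{i+1}^-$, and to no vertex in any other cell. 3. Each $z\in C_i^+$ is adjacent to exactly $\widetilde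 c_i$ vertices in $C_{i-1}^+$ (when $i\ge1$), $c_{i+1}-\widetilde c_i$ vertices in $C_i^-$, $\widetilde a_i-c_{i+1}+\widetilde c_i$ vertices in $C_i^+$, $\widetilde b_i-b_{i+1}$ vertices in $C_{i+1}^-$, $b_{i+1}$ vertices in $C_{i+1}^+$, and to no vertex in any other cell. -/

import Mathlib

namespace DelsarteClique

/-- The set `Γ_i(x)` of vertices at path-length distance `i` from `x`. -/
noncomputable def sphere {V : Type*} [Fintype V] (G : SimpleGraph V) (i : ℕ) (x : V) :
    Finset V :=
  Finset.univ.filter (fun y => G.dist x y = i)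

/-- The number of neighbours of `z` in the set `S`. -/
def nbrs {V : Type*} (G : SimpleGraph V) [DecidableRel G.Adj] (z : V) (S : Finset V) : ℕ :=
  (S.filter (fun w => G.Adj z w)).card

/-- `G` is a (connected) distance-regular graph with intersection numbers `p h i j = p^h_{i,j}`:
for all vertices `x, y` at distance `h`, exactly `p h i j` vertices are at distance `i` from `x`
and at distance `j` from `y`.  (If `i` or `j` exceeds the diameter this just says that
`p h i j = 0` for all `h` up to the diameter.) -/
structure IsDistanceRegularWith {V : Type*} [Fintype V] [DecidableEq V] (G : SimpleGraph V)
    (p : ℕ → ℕ → ℕ → ℕ) : Prop where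
  connected : G.Connected
  card_inter : ∀ (x y : V) (i j : ℕ), (sphere G i x ∩ sphere G j y).card = p (G.dist x y) i j

/-- `a_i = p^i_{1,i}`. -/
def aNum (p : ℕ → ℕ → ℕ → ℕ) (i : ℕ) : ℕ := p i 1 i

/-- `b_i = p^i_{1,i+1}`; for a graph of diameter `d` this gives `b_d = 0`. -/
def bNum (p : ℕ → ℕ → ℕ → ℕ) (i : ℕ) : ℕ := p i 1 (i + 1)

/-- `c_i = p^i_{1,i-1}`; here `c_0` is `p^0_{1,0} = 0`. -/
def cNum (p : ℕ → ℕ → ℕ → ℕ) (i : ℕ) : ℕ := p i 1 (i - 1)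

/-- A Delsarte clique of a `k`-regular graph with least adjacency eigenvalue `θ`: a nonempty
clique `C` with `|C| = 1 - k / θ`. -/
def IsDelsarteClique {V : Type*} [Fintype V] [DecidableEq V] (G : SimpleGraph V)
    [DecidableRel G.Adj] (C : Finset V) : Prop :=
  C.Nonempty ∧ G.IsClique (C : Set V) ∧
    ∃ (k : ℕ) (θ : ℝ), G.IsRegularOfDegree k ∧
      IsLeast {t : ℝ | Module.End.HasEigenvalue (Matrix.toLin' (G.adjMatrix ℝ)) t} θ ∧
      (C.card : ℝ) = 1 - (k : ℝ) / θ

/-- `∂(y, C) = min {∂(y, z) | z ∈ C}` (for nonempty `C`). -/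
noncomputable def distTo {V : Type*} (G : SimpleGraph V) (C : Finset V) (y : V) : ℕ :=
  sInf {n : ℕ | ∃ z ∈ C, G.dist y z = n}

/-- `C_i = {y | ∂(y, C) = i}`. -/
noncomputable def layer {V : Type*} [Fintype V] (G : SimpleGraph V) (C : Finset V) (i : ℕ) :
    Finset V :=
  Finset.univ.filter (fun y => distTo G C y = i)

/-- `C_i^- = C_i ∩ Γ_i(x)`. -/
noncomputable def cellMinus {V : Type*} [Fintype V] [DecidableEq V] (G : SimpleGraph V)
    (C : Finset V) (x : V) (i : ℕ) : Finset V :=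
  layer G C i ∩ sphere G i x

/-- `C_i^+ = C_i ∩ Γ_{i+1}(x)`. -/
noncomputable def cellPlus {V : Type*} [Fintype V] [DecidableEq V] (G : SimpleGraph V)
    (C : Finset V) (x : V) (i : ℕ) : Finset V :=
  layer G C i ∩ sphere G (i + 1) x

/-- The family of the `2 d` sets `C_i^-` (index `(i, false)`) and `C_i^+` (index `(i, true)`),
for `0 ≤ i ≤ d - 1`. -/
noncomputable def cells {V : Type*} [Fintype V] [DecidableEq V] (G : SimpleGraph V)
    (C : Finset V) (x : V) (d : ℕ) : Fin d × Bool → Finset V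
  | (i, false) => cellMinus G C x i
  | (i, true) => cellPlus G C x i

/-- The family `P` is a partition of the vertex set: its members are nonempty, mutually disjoint,
and their union is the whole vertex set. -/
structure IsPartition {V ι : Type*} (P : ι → Finset V) : Prop where
  nonempty : ∀ s, (P s).Nonempty
  disjoint : ∀ s t, s ≠ t → Disjoint (P s) (P t)
  cover : ∀ y, ∃ s, y ∈ P s

/-- The partition `P` of the vertex set is equitable: for all cells `P s` and `P t`, all vertices
in `P s` have the same number of neighbours in `P t`. -/
structure IsEquitablePartition {V ι : Type*} (G : SimpleGraph V) [DecidableRel G.Adj]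
    (P : ι → Finset V) : Prop where
  isPartition : IsPartition P
  equitable : ∀ s t, ∀ u ∈ P s, ∀ v ∈ P s, nbrs G u (P t) = nbrs G v (P t)

/-- The numbers `ã_i = ta i`, `b̃_i = tb i`, `c̃_i = tc i` for `0 ≤ i ≤ d - 1`: each vertex
`z ∈ C_i` has `c̃_i` neighbours in `C_{i-1}`, `ã_i` in `C_i` and `b̃_i` in `C_{i+1}`,
where `C_{-1}` is empty. -/
structure IsLayerNumbers {V : Type*} [Fintype V] (G : SimpleGraph V) [DecidableRel G.Adj]
    (C : Finset V) (d : ℕ) (ta tb tc : ℕ → ℕ) : Prop where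
  c_zero : tc 0 = 0
  c_succ : ∀ i, i + 1 < d → ∀ z ∈ layer G C (i + 1), nbrs G z (layer G C i) = tc (i + 1)
  a_eq : ∀ i, i < d → ∀ z ∈ layer G C i, nbrs G z (layer G C i) = ta i
  b_eq : ∀ i, i < d → ∀ z ∈ layer G C i, nbrs G z (layer G C (i + 1)) = tb i

end DelsarteClique

namespace DelsarteClique

open Finset
open scoped Matrix

variable {V : Type*}

/-! Let `u` be the cosine sequence of the least eigenvalue `θ`: the function `y ↦ u (G.dist x y)` is
a `θ`-eigenfunction with value `1` at `x`. As `u 1 = θ / k`, the Delsarte equality says exactly that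
`u` summed over all pairs of vertices of `C` gives `0`. This sum is a positive multiple of the
squared norm of the projection of the indicator of `C` to the `θ`-eigenspace, so the sum of `u
(G.dist y z)` over `z ∈ C` vanishes for every vertex `y` (`IsDelsarteClique.exists_cosines`).

Since `C` is a clique, a vertex `y` of layer `i` sees `C` only at distances `i` and `i + 1`. With
`N` the number of nearest vertices, the relation reads `N * u i + (|C| - N) * u (i + 1) = 0`.
Minimality of `θ` makes `u` alternate strictly in sign, so `N` depends only on `i` and `0 < N < |C|`
(`IsDelsarteClique.exists_near`). In particular some vertex of `C` is at distance `i + 1` from `y`,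
whence `i < d`.

Double counting against the nearest and the non-nearest vertices of `C` then shows that the layers
form an equitable partition (`near_mul_nbrs_pred`, `far_mul_nbrs_succ`). The cells refine layers by
spheres around `x`. The triangle inequality leaves so few cells for the neighbours of a vertex that
the known counts in layers and in spheres determine all the others; the cell sizes follow by
counting edges between consecutive cells. -/

@[simp]
lemma mem_sphere [Fintype V] {G : SimpleGraph V} {i : ℕ} {x y : V} : y ∈ sphere G i x ↔ G.dist x y = i := by
  simp [sphere]

lemma mem_sphere_one [Fintype V] {G : SimpleGraph V} {x y : V} : y ∈ sphere G 1 x ↔ G.Adj x y := by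
  simp [SimpleGraph.dist_eq_one_iff_adj]

/-- In a connected graph, a vertex at distance `n + 1` from `x` has a neighbour at distance `n`. -/
lemma exists_adj_dist_eq {G : SimpleGraph V} (hG : G.Connected) {x y : V} {n : ℕ}
    (h : G.dist x y = n + 1) : ∃ w, G.Adj y w ∧ G.dist x w = n := by
  obtain ⟨q, hq⟩ := hG.exists_walk_length_eq_dist y x
  rw [SimpleGraph.dist_comm, h] at hq
  cases q with
  | nil => simp at hq
  | cons hadj q =>
    rename_i w
    refine ⟨w, hadj, ?_⟩
    have h1 := SimpleGraph.dist_le q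
    have h2 := hG.dist_triangle (u := x) (v := w) (w := y)
    rw [SimpleGraph.dist_eq_one_iff_adj.2 hadj.symm, h] at h2
    rw [SimpleGraph.dist_comm] at h1
    simp only [SimpleGraph.Walk.length_cons] at hq
    omega

lemma exists_dist_eq_of_le {G : SimpleGraph V} (hG : G.Connected) {x y : V} {n : ℕ}
    (h : n ≤ G.dist x y) : ∃ w, G.dist x w = n ∧ G.dist w y = G.dist x y - n := by
  obtain ⟨m, hm⟩ := Nat.exists_eq_add_of_le h
  induction m generalizing y with
  | zero => exact ⟨y, by simpa using hm, by simp [hm]⟩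
  | succ m ih =>
    obtain ⟨y', hadj, hy'⟩ := exists_adj_dist_eq hG (n := n + m) (by omega : G.dist x y = n + m + 1)
    obtain ⟨w, hw, hw'⟩ := ih (y := y') (by omega) hy'
    refine ⟨w, hw, ?_⟩
    have h1 := hG.dist_triangle (u := w) (v := y') (w := y)
    rw [SimpleGraph.dist_eq_one_iff_adj.2 hadj.symm] at h1
    have h2 := hG.dist_triangle (u := x) (v := w) (w := y)
    omega

/-- `f` satisfies the eigenvalue equation of the adjacency matrix for `θ`. -/
def IsEigenfunction [Fintype V] (G : SimpleGraph V) (θ : ℝ) (f : V → ℝ) : Prop :=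
  ∀ y, ∑ w ∈ sphere G 1 y, f w = θ * f y

lemma isEigenfunction_iff_mulVec [Fintype V] [DecidableEq V] {G : SimpleGraph V} [DecidableRel G.Adj]
    {θ : ℝ} {f : V → ℝ} : IsEigenfunction G θ f ↔ G.adjMatrix ℝ *ᵥ f = θ • f := by
  have h : ∀ y, sphere G 1 y = G.neighborFinset y := fun y => by
    ext w; simp [mem_sphere_one, -mem_sphere]
  simp [IsEigenfunction, funext_iff, SimpleGraph.adjMatrix_mulVec_apply, h]

lemma IsEigenfunction.sum [Fintype V] {ι : Type*} {G : SimpleGraph V} {θ : ℝ} (s : Finset ι) {f : ι → V → ℝ}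
    (h : ∀ i ∈ s, IsEigenfunction G θ (f i)) : IsEigenfunction G θ (fun y => ∑ i ∈ s, f i y) := by
  intro y
  rw [sum_comm, mul_sum]
  exact sum_congr rfl fun i hi => h i hi y

lemma sum_eq_sum_sphere {G : SimpleGraph V} {D : ℕ} (hD : ∀ x y, G.dist x y < D) (x : V)
    (s : Finset V) (f : V → ℝ) :
    ∑ w ∈ s, f w = ∑ j ∈ range D, ∑ w ∈ s with G.dist x w = j, f w :=
  (sum_fiberwise_of_maps_to (fun w _ => mem_range.2 (hD x w)) f).symm

/-! ### Cosine sequences of eigenvalues of a distance-regular graph. -/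

section Regular

variable [Fintype V] [DecidableEq V] {G : SimpleGraph V} {p : ℕ → ℕ → ℕ → ℕ}

lemma IsDistanceRegularWith.card_sphere (hG : IsDistanceRegularWith G p) (x : V) (i : ℕ) :
    (sphere G i x).card = p 0 i i := by
  have := hG.card_inter x x i i
  simpa using this

lemma IsDistanceRegularWith.card_filter_sphere (hG : IsDistanceRegularWith G p) (x y : V) (j : ℕ) :
    ((sphere G 1 y).filter (fun w => G.dist x w = j)).card = p (G.dist x y) 1 j := by
  rw [SimpleGraph.dist_comm, ← hG.card_inter y x 1 j]
  congr 1
  ext w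
  simp

/-- Both sides count the adjacent pairs between the spheres of radii `i` and `j` around one vertex.
-/
lemma IsDistanceRegularWith.card_mul_comm (hG : IsDistanceRegularWith G p) [Nonempty V] (i j : ℕ) :
    p 0 i i * p i 1 j = p 0 j j * p j 1 i := by
  classical
  obtain ⟨x⟩ := ‹Nonempty V›
  have key : ∀ i j, p 0 i i * p i 1 j =
      ∑ y ∈ sphere G i x, ∑ w ∈ sphere G j x, if G.Adj y w then 1 else 0 := by
    intro i j
    rw [← hG.card_sphere x i, card_eq_sum_ones, sum_mul]
    refine sum_congr rfl fun y hy => ?_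
    rw [one_mul, ← mem_sphere.1 hy, ← hG.card_filter_sphere x y j, ← card_filter]
    congr 1
    ext w
    simp [SimpleGraph.dist_eq_one_iff_adj, and_comm]
  rw [key, key, sum_comm]
  simp only [G.adj_comm]

/-- Sum the eigenvalue equation over a sphere and exchange the order of summation. This is the
recurrence behind the cosine sequence. -/
lemma IsDistanceRegularWith.mul_sum_sphere (hG : IsDistanceRegularWith G p) {D : ℕ}
    (hD : ∀ x y, G.dist x y < D) {θ : ℝ} {f : V → ℝ} (hf : IsEigenfunction G θ f) (x : V) (i : ℕ) :
    θ * ∑ y ∈ sphere G i x, f y = ∑ j ∈ range D, p j 1 i * ∑ w ∈ sphere G j x, f w := by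
  have h1 : θ * ∑ y ∈ sphere G i x, f y = ∑ w, p (G.dist x w) 1 i * f w := by
    calc θ * ∑ y ∈ sphere G i x, f y = ∑ y ∈ sphere G i x, ∑ w ∈ sphere G 1 y, f w := by
          rw [mul_sum]; exact sum_congr rfl fun y _ => (hf y).symm
      _ = ∑ w, ∑ y ∈ (sphere G 1 w).filter (fun y => G.dist x y = i), f w := by
          refine sum_comm' fun y w => ?_
          simp [SimpleGraph.dist_comm, and_comm]
      _ = _ := by
          refine sum_congr rfl fun w _ => ?_
          rw [sum_const, hG.card_filter_sphere, nsmul_eq_mul]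
  rw [h1, sum_eq_sum_sphere hD x]
  refine sum_congr rfl fun j _ => ?_
  rw [mul_sum]
  refine sum_congr rfl fun w hw => ?_
  rw [(mem_filter.1 hw).2]

/-- Sums of an eigenfunction over a sphere are a fixed multiple of the value at the centre. -/
lemma IsDistanceRegularWith.exists_sum_sphere (hG : IsDistanceRegularWith G p) {D : ℕ}
    (hD : ∀ x y, G.dist x y < D) (θ : ℝ) (i : ℕ) :
    ∃ r : ℝ, ∀ f, IsEigenfunction G θ f → ∀ x, ∑ y ∈ sphere G i x, f y = r * f x := by
  induction i using Nat.strong_induction_on with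
  | _ i ih =>
  cases i with
  | zero =>
    refine ⟨1, fun f _ x => ?_⟩
    have : sphere G 0 x = {x} := by
      ext y; simp [hG.connected.dist_eq_zero_iff, eq_comm]
    simp [this]
  | succ i =>
    by_cases h0 : ∃ x y, G.dist x y = i + 1
    · obtain ⟨x₀, y₀, hxy⟩ := h0
      -- When distance `i + 1` occurs, the leading coefficient of the recurrence is nonzero, so it
      -- can be solved for the sum over the sphere of radius `i + 1`.
      have hc : (p (i + 1) 1 i : ℝ) ≠ 0 := by
        obtain ⟨w, hw, hw'⟩ := exists_adj_dist_eq hG.connected hxy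
        rw [← hxy, ← hG.card_filter_sphere]
        exact_mod_cast (card_pos.2 ⟨w, by simp [SimpleGraph.dist_eq_one_iff_adj, hw, hw']⟩).ne'
      choose! v hv using ih
      refine ⟨(θ * v i - ∑ j ∈ range (i + 1), p j 1 i * v j) / p (i + 1) 1 i, fun f hf x => ?_⟩
      have h1 := hG.mul_sum_sphere hD hf x i
      have hlt : i + 1 < D := hxy ▸ hD x₀ y₀
      have h2 : ∑ j ∈ range D, (p j 1 i : ℝ) * ∑ w ∈ sphere G j x, f w =
          ∑ j ∈ range (i + 2), (p j 1 i : ℝ) * ∑ w ∈ sphere G j x, f w := by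
        symm
        refine sum_subset (range_subset_range.2 (by omega)) fun j _ hj => ?_
        rcases (sphere G j x).eq_empty_or_nonempty with he | ⟨w, hw⟩
        · simp [he]
        · have : p j 1 i = 0 := by
            rw [← mem_sphere.1 hw, ← hG.card_filter_sphere, card_eq_zero,
              filter_eq_empty_iff]
            intro u hu hu'
            have h3 := hG.connected.dist_triangle (u := x) (v := u) (w := w)
            rw [SimpleGraph.dist_comm (u := u), mem_sphere.1 hu, mem_sphere.1 hw] at h3
            simp only [mem_range] at hj
            omega
          simp [this]
      rw [h2, sum_range_succ, hv i (by omega) f hf x] at h1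
      have h3 : ∑ j ∈ range (i + 1), (p j 1 i : ℝ) * ∑ w ∈ sphere G j x, f w =
          (∑ j ∈ range (i + 1), (p j 1 i : ℝ) * v j) * f x := by
        rw [sum_mul]
        refine sum_congr rfl fun j hj => ?_
        rw [hv j (by simpa using hj) f hf x, mul_assoc]
      rw [h3] at h1
      rw [div_mul_eq_mul_div, eq_div_iff hc]
      linarith
    · refine ⟨0, fun f _ x => ?_⟩
      have : sphere G (i + 1) x = ∅ := by
        rw [eq_empty_iff_forall_notMem]
        intro y hy
        exact h0 ⟨x, y, mem_sphere.1 hy⟩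
      simp [this]

/-- The cosine sequence of an eigenvalue: the functions `y ↦ u (dist x y)` are eigenfunctions
with value `1` at `x`, and each eigenfunction has average `u i * f x` over the sphere of radius
`i` around `x`. -/
structure IsCosineSequence (G : SimpleGraph V) (θ : ℝ) (u : ℕ → ℝ) : Prop where
  zero : u 0 = 1
  eigen : ∀ x, IsEigenfunction G θ (fun y => u (G.dist x y))
  sum_sphere : ∀ f, IsEigenfunction G θ f → ∀ x i,
    ∑ y ∈ sphere G i x, f y = (sphere G i x).card * u i * f x

/-- Divide the sphere multipliers `v i` by the sphere sizes. The recurrence for `v` turns into the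
eigenvalue equation through the symmetry `card_mul_comm`. -/
lemma IsDistanceRegularWith.exists_isCosineSequence (hG : IsDistanceRegularWith G p) {D : ℕ}
    (hD : ∀ x y, G.dist x y < D) {θ : ℝ} {f : V → ℝ} (hf : IsEigenfunction G θ f) (hf0 : f ≠ 0) :
    ∃ u : ℕ → ℝ, IsCosineSequence G θ u := by
  choose v hv using hG.exists_sum_sphere hD θ
  obtain ⟨x₀, hx₀⟩ := Function.ne_iff.1 hf0
  simp only [Pi.zero_apply] at hx₀
  have : Nonempty V := ⟨x₀⟩
  -- For empty spheres this makes the division by zero in `v j / p 0 j j` harmless.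
  have hv0 : ∀ j, p 0 j j = 0 → v j = 0 := by
    intro j hj
    have h1 := hv j f hf x₀
    rw [← hG.card_sphere x₀, card_eq_zero] at hj
    rw [hj, sum_empty] at h1
    exact (mul_eq_zero.1 h1.symm).resolve_right hx₀
  have hmul : ∀ j, (p 0 j j : ℝ) * (v j / p 0 j j) = v j := by
    intro j
    by_cases hj : p 0 j j = 0
    · simp [hj, hv0 j hj]
    · field_simp
  have hrec : ∀ i, θ * v i = ∑ j ∈ range D, p j 1 i * v j := by
    intro i
    have h1 := hG.mul_sum_sphere hD hf x₀ i
    simp only [hv _ f hf x₀, ← mul_assoc] at h1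
    rw [← sum_mul] at h1
    exact mul_right_cancel₀ hx₀ h1
  refine ⟨fun i => v i / p 0 i i, ?_, ?_, ?_⟩
  · have hs : sphere G 0 x₀ = {x₀} := by
      ext y; simp [hG.connected.dist_eq_zero_iff, eq_comm]
    have h0 := hv 0 f hf x₀
    rw [hs, sum_singleton] at h0
    have : p 0 0 0 = 1 := by rw [← hG.card_sphere x₀, hs, card_singleton]
    have h1 : v 0 = 1 := mul_right_cancel₀ hx₀ (by linarith)
    simp [this, h1]
  · intro x y
    have hk : (p 0 (G.dist x y) (G.dist x y) : ℝ) ≠ 0 := by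
      rw [← hG.card_sphere x]
      exact_mod_cast (card_pos.2 ⟨y, by simp⟩).ne'
    rw [sum_eq_sum_sphere hD x]
    have h1 : ∀ j ∈ range D, ∑ w ∈ sphere G 1 y with G.dist x w = j,
        v (G.dist x w) / (p 0 (G.dist x w) (G.dist x w) : ℝ) =
        p j 1 (G.dist x y) * v j / p 0 (G.dist x y) (G.dist x y) := by
      intro j _
      rw [sum_congr rfl (g := fun _ => v j / (p 0 j j : ℝ))
        (fun w hw => by rw [(mem_filter.1 hw).2]), sum_const, hG.card_filter_sphere, nsmul_eq_mul,
        eq_div_iff hk]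
      have h2 : (p 0 (G.dist x y) (G.dist x y) : ℝ) * p (G.dist x y) 1 j =
        p 0 j j * p j 1 (G.dist x y) := by exact_mod_cast hG.card_mul_comm _ _
      calc _ = ((p 0 (G.dist x y) (G.dist x y) : ℝ) * p (G.dist x y) 1 j) * (v j / p 0 j j) := by
            ring
        _ = p j 1 (G.dist x y) * (p 0 j j * (v j / p 0 j j)) := by rw [h2]; ring
        _ = _ := by rw [hmul]
    rw [sum_congr rfl h1, ← sum_div, ← hrec, mul_div_assoc]
  · intro g hg x i
    rw [hv i g hg x, hG.card_sphere, hmul]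

/-! ### The least eigenvalue: sign alternation and Delsarte cliques. -/

/-- The quadratic form of `A - θ` at the least eigenvalue `θ` is nonnegative and vanishes only on
eigenfunctions. -/
lemma isEigenfunction_of_le [DecidableRel G.Adj] {θ : ℝ}
    (hθ : IsLeast {t : ℝ | Module.End.HasEigenvalue (Matrix.toLin' (G.adjMatrix ℝ)) t} θ)
    {f : V → ℝ} (hf : ∑ y, f y * ∑ w ∈ sphere G 1 y, f w ≤ ∑ y, f y * (θ * f y)) :
    IsEigenfunction G θ f := by
  set B : Matrix V V ℝ := G.adjMatrix ℝ - θ • 1 with hB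
  have hBv : ∀ g : V → ℝ, B *ᵥ g = G.adjMatrix ℝ *ᵥ g - θ • g := by
    intro g
    rw [hB, Matrix.sub_mulVec, Matrix.smul_mulVec, Matrix.one_mulVec]
  have hH : B.IsHermitian := by
    refine Matrix.IsHermitian.ext fun i j => ?_
    simp [hB, SimpleGraph.adjMatrix_apply, G.adj_comm, Matrix.one_apply, eq_comm]
  have hP : B.PosSemidef := by
    rw [hH.posSemidef_iff_eigenvalues_nonneg]
    intro j
    have h1 := hH.mulVec_eigenvectorBasis j
    rw [hBv] at h1
    -- Adding `θ` to an eigenvalue of `B` gives an eigenvalue of the adjacency matrix, so minimality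
    -- of `θ` makes every eigenvalue of `B` nonnegative.
    have h2 : Module.End.HasEigenvalue (Matrix.toLin' (G.adjMatrix ℝ)) (hH.eigenvalues j + θ) := by
      refine Module.End.hasEigenvalue_of_hasEigenvector (x := ⇑(hH.eigenvectorBasis j)) ⟨?_, ?_⟩
      · rw [Module.End.mem_eigenspace_iff, Matrix.toLin'_apply, add_smul, ← h1]
        simp
      · intro h0
        have := hH.eigenvectorBasis.orthonormal.ne_zero j
        apply this
        ext i
        exact congrFun h0 i
    have := hθ.2 h2
    simpa using this
  have hA : ∀ y, (G.adjMatrix ℝ *ᵥ f) y = ∑ w ∈ sphere G 1 y, f w := by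
    intro y
    rw [SimpleGraph.adjMatrix_mulVec_apply]
    congr 1
    ext w; simp [mem_sphere_one, -mem_sphere]
  have hq : star f ⬝ᵥ B *ᵥ f =
      ∑ y, f y * ∑ w ∈ sphere G 1 y, f w - ∑ y, f y * (θ * f y) := by
    rw [hBv, dotProduct, ← sum_sub_distrib]
    refine sum_congr rfl fun y _ => ?_
    simp [hA, mul_sub]
  have h0 : star f ⬝ᵥ B *ᵥ f = 0 :=
    le_antisymm (by rw [hq]; linarith) (hP.dotProduct_mulVec_nonneg f)
  rw [hP.dotProduct_mulVec_zero_iff, hBv, sub_eq_zero] at h0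
  exact isEigenfunction_iff_mulVec.2 h0

/-- The cosine sequence of the least eigenvalue alternates weakly in sign. -/
lemma IsCosineSequence.eq_alternating [DecidableRel G.Adj] {θ : ℝ}
    (hθ : IsLeast {t : ℝ | Module.End.HasEigenvalue (Matrix.toLin' (G.adjMatrix ℝ)) t} θ)
    {u : ℕ → ℝ} (hu : IsCosineSequence G θ u) (x y : V) :
    u (G.dist x y) = (-1) ^ G.dist x y * |u (G.dist x y)| := by
  -- Forcing alternating signs keeps the norm and does not increase the quadratic form: edges within
  -- a sphere contribute the same, edges between consecutive spheres contribute minus an absolute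
  -- value.
  have hf : IsEigenfunction G θ (fun y => (-1) ^ G.dist x y * |u (G.dist x y)|) := by
    refine isEigenfunction_of_le hθ ?_
    calc _ ≤ ∑ y, u (G.dist x y) * ∑ w ∈ sphere G 1 y, u (G.dist x w) := by
          refine sum_le_sum fun y _ => ?_
          rw [mul_sum, mul_sum]
          refine sum_le_sum fun w hw => ?_
          rcases SimpleGraph.Adj.diff_dist_adj (u := x) (mem_sphere_one.1 hw) with h | h | h
          · rw [h]
            have h1 : ((-1 : ℝ) ^ G.dist x y) * (-1) ^ G.dist x y = 1 := by
              rw [← mul_pow]; simp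
            rw [mul_mul_mul_comm, h1, one_mul, abs_mul_abs_self]
          · rw [h]
            have h1 : ((-1 : ℝ) ^ G.dist x y) * (-1) ^ (G.dist x y + 1) = -1 := by
              rw [pow_succ, ← mul_assoc, ← mul_pow]; simp
            rw [mul_mul_mul_comm, h1, ← abs_mul]
            linarith [neg_abs_le (u (G.dist x y) * u (G.dist x y + 1))]
          -- At `y = x` the truncated subtraction turns this case into that of equal distances.
          · by_cases h0 : G.dist x y = 0
            · have : G.dist x w = G.dist x y := by rw [h, h0]
              rw [this]
              have h1 : ((-1 : ℝ) ^ G.dist x y) * (-1) ^ G.dist x y = 1 := by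
                rw [← mul_pow]; simp
              rw [mul_mul_mul_comm, h1, one_mul, abs_mul_abs_self]
            obtain ⟨m, hm⟩ := Nat.exists_eq_succ_of_ne_zero h0
            rw [h, hm]
            simp only [Nat.succ_eq_add_one, Nat.add_sub_cancel]
            have h1 : ((-1 : ℝ) ^ (m + 1)) * (-1) ^ m = -1 := by
              rw [pow_succ, mul_right_comm, ← mul_pow]; simp
            rw [mul_mul_mul_comm, h1, ← abs_mul]
            linarith [neg_abs_le (u (m + 1) * u m)]
      _ = ∑ y, u (G.dist x y) * (θ * u (G.dist x y)) :=
          sum_congr rfl fun y _ => by rw [hu.eigen x y]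
      _ = _ := by
          refine sum_congr rfl fun y _ => ?_
          have h1 : ((-1 : ℝ) ^ G.dist x y) * (-1) ^ G.dist x y = 1 := by
            rw [← mul_pow]; simp
          calc _ = θ * (u (G.dist x y) * u (G.dist x y)) := by ring
            _ = θ * (((-1 : ℝ) ^ G.dist x y * (-1) ^ G.dist x y) *
                  (|u (G.dist x y)| * |u (G.dist x y)|)) := by
                rw [h1, abs_mul_abs_self, one_mul]
            _ = _ := by ring
  -- The modified function is constant on spheres around `x` and is `1` at `x`, so its sphere
  -- average gives back `u`.
  have h1 := hu.sum_sphere _ hf x (G.dist x y)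
  rw [sum_congr rfl (g := fun _ => (-1 : ℝ) ^ G.dist x y * |u (G.dist x y)|)
    (fun w hw => by rw [mem_sphere.1 hw]), sum_const, nsmul_eq_mul] at h1
  have hk : ((sphere G (G.dist x y) x).card : ℝ) ≠ 0 := by
    exact_mod_cast (card_pos.2 ⟨y, by simp⟩).ne'
  simp only [SimpleGraph.dist_self, pow_zero, hu.zero, abs_one, mul_one] at h1
  exact (mul_left_cancel₀ hk h1).symm

lemma IsCosineSequence.ne_zero (hG : G.Connected) [DecidableRel G.Adj] {θ : ℝ}
    (hθ : IsLeast {t : ℝ | Module.End.HasEigenvalue (Matrix.toLin' (G.adjMatrix ℝ)) t} θ)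
    {u : ℕ → ℝ} (hu : IsCosineSequence G θ u) (x y : V) :
    u (G.dist x y) ≠ 0 := by
  obtain ⟨n, hn⟩ : ∃ n, G.dist x y = n := ⟨_, rfl⟩
  induction n generalizing y with
  | zero => rw [hn, hu.zero]; exact one_ne_zero
  | succ n ih =>
    intro h0
    obtain ⟨w, hw, hw'⟩ := exists_adj_dist_eq hG hn
    have h1 : ∑ w ∈ sphere G 1 y, u (G.dist x w) = θ * u (G.dist x y) := hu.eigen x y
    rw [h0, mul_zero] at h1
    refine ih w hw' ?_
    -- If `u (n + 1) = 0`, the neighbours of `y` that may contribute lie at distances `n` and `n +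
    -- 2`, of equal parity. Their values have one sign and sum to `0`, so `u n = 0`, and the zero
    -- descends to `u 0 = 1`.
    have h2 : ∀ z ∈ sphere G 1 y, 0 ≤ (-1) ^ n * u (G.dist x z) := by
      intro z hz
      have h3 := hu.eq_alternating hθ x z
      have hz' := hn ▸ SimpleGraph.Adj.diff_dist_adj (u := x) (mem_sphere_one.1 hz)
      rcases hz' with h | h | h
      · rw [h, ← hn, h0, mul_zero]
      · rw [h3, h, ← mul_assoc, ← pow_add]
        have : Even (n + (n + 1 + 1)) := ⟨n + 1, by ring⟩
        rw [this.neg_one_pow, one_mul]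
        positivity
      · rw [h3, h, ← mul_assoc, ← pow_add]
        have : Even (n + (n + 1 - 1)) := ⟨n, by simp⟩
        rw [this.neg_one_pow, one_mul]
        positivity
    have h4 : ∑ z ∈ sphere G 1 y, (-1) ^ n * u (G.dist x z) = 0 := by
      rw [← mul_sum, h1, mul_zero]
    have h5 := (sum_eq_zero_iff_of_nonneg h2).1 h4 w (mem_sphere_one.2 hw)
    exact (mul_eq_zero.1 h5).resolve_left (by simp)

lemma IsCosineSequence.alternating (hG : G.Connected) [DecidableRel G.Adj] {θ : ℝ}
    (hθ : IsLeast {t : ℝ | Module.End.HasEigenvalue (Matrix.toLin' (G.adjMatrix ℝ)) t} θ)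
    {u : ℕ → ℝ} (hu : IsCosineSequence G θ u) (x y : V) :
    0 < (-1) ^ G.dist x y * u (G.dist x y) := by
  rw [hu.eq_alternating hθ x y, ← mul_assoc, ← mul_pow]
  simpa using hu.ne_zero hG hθ x y

/-- If the quadratic form of a cosine sequence vanishes on `C`, then the sum of its
eigenfunctions centred at the points of `C` vanishes. -/
lemma IsCosineSequence.sum_eq_zero {D : ℕ} (hD : ∀ x y, G.dist x y < D) {θ : ℝ}
    {u : ℕ → ℝ} (hu : IsCosineSequence G θ u) (hG : IsDistanceRegularWith G p) {C : Finset V}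
    (hC : ∑ y ∈ C, ∑ z ∈ C, u (G.dist z y) = 0) (y : V) :
    ∑ z ∈ C, u (G.dist z y) = 0 := by
  set g : V → ℝ := fun y => ∑ z ∈ C, u (G.dist z y) with hg
  have hge : IsEigenfunction G θ g := IsEigenfunction.sum C fun z _ => hu.eigen z
  set c : ℝ := ∑ j ∈ range D, u j * (p 0 j j * u j)
  have hUg : ∀ z, ∑ y, u (G.dist z y) * g y = c * g z := by
    intro z
    rw [sum_eq_sum_sphere hD z, sum_mul]
    refine sum_congr rfl fun j _ => ?_
    have h1 := hu.sum_sphere g hge z j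
    rw [hG.card_sphere] at h1
    rw [mul_assoc, ← h1, mul_sum]
    refine sum_congr rfl fun w hw => ?_
    rw [(mem_filter.1 hw).2]
  -- Convolution with `u` scales `g` by `c`, so the squared norm of `g` is `c` times the sum of `g`
  -- over `C`.
  have h0 : ∑ y, g y * g y = 0 := by
    calc ∑ y, g y * g y = ∑ z ∈ C, ∑ y, u (G.dist z y) * g y := by
          rw [sum_comm]
          exact sum_congr rfl fun y _ => by rw [← sum_mul]
      _ = c * ∑ z ∈ C, g z := by rw [mul_sum]; exact sum_congr rfl fun z _ => hUg z
      _ = 0 := by rw [hC, mul_zero]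
  have := (sum_eq_zero_iff_of_nonneg fun y _ => mul_self_nonneg (g y)).1 h0 y (mem_univ y)
  exact mul_self_eq_zero.1 this

/-- A Delsarte clique is orthogonal to the least eigenspace, whose cosine sequence alternates. -/
lemma IsDelsarteClique.exists_cosines [DecidableRel G.Adj] (hG : IsDistanceRegularWith G p) {D : ℕ}
    (hD : ∀ x y, G.dist x y < D) {C : Finset V} (hC : IsDelsarteClique G C)
    (hcard : Nontrivial V) :
    1 < C.card ∧ ∃ u : ℕ → ℝ, (∀ y, ∑ z ∈ C, u (G.dist y z) = 0) ∧
      ∀ x y, 0 < (-1) ^ G.dist x y * u (G.dist x y) := by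
  obtain ⟨⟨x, hx⟩, hcl, k, θ, hk, hθ, hCk⟩ := hC
  obtain ⟨f, hf⟩ := hθ.1.exists_hasEigenvector
  have hfe : IsEigenfunction G θ f := by
    have := hf.apply_eq_smul
    rw [Matrix.toLin'_apply] at this
    exact isEigenfunction_iff_mulVec.2 this
  obtain ⟨u, hu⟩ := hG.exists_isCosineSequence hD hfe hf.2
  have halt := hu.alternating hG.connected hθ
  have hs : sphere G 1 x = G.neighborFinset x := by
    ext w; simp [mem_sphere_one, -mem_sphere]
  have hθu : k * u 1 = θ := by
    have h1 : ∑ w ∈ sphere G 1 x, u (G.dist x w) = θ * u (G.dist x x) := hu.eigen x x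
    rw [sum_congr rfl (g := fun _ => u 1) (fun w hw => by rw [mem_sphere.1 hw]), sum_const, hs,
      SimpleGraph.card_neighborFinset_eq_degree, hk.degree_eq, nsmul_eq_mul] at h1
    simpa [hu.zero] using h1
  obtain ⟨w, hw⟩ := hG.connected.preconnected.exists_adj_of_nontrivial x
  have hk0 : (0 : ℝ) < k := by
    have : 0 < k := by
      rw [← hk.degree_eq x, G.degree_pos_iff_exists_adj]
      exact ⟨w, hw⟩
    exact_mod_cast this
  have hu1 : u 1 < 0 := by
    have := halt x w
    rw [SimpleGraph.dist_eq_one_iff_adj.2 hw] at this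
    linarith
  have hθ0 : θ < 0 := by rw [← hθu]; exact mul_neg_of_pos_of_neg hk0 hu1
  -- The Delsarte equality rewritten: each row `1 + (|C| - 1) * u 1` of the form on `C` is zero.
  have hCu : ((C.card : ℝ) - 1) * u 1 = -1 := by
    rw [hCk, ← hθu]
    field_simp [hu1.ne]
    ring
  refine ⟨?_, u, fun y => ?_, halt⟩
  · have h1 : 0 < -((k : ℝ) / θ) := by
      rw [← div_neg]; exact div_pos hk0 (by linarith)
    have : (1 : ℝ) < C.card := by rw [hCk]; linarith
    exact_mod_cast this
  · have h2 := hu.sum_eq_zero hD hG (C := C) (sum_eq_zero fun y hy => ?_) y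
    · simpa only [SimpleGraph.dist_comm] using h2
    · rw [← add_sum_erase _ _ hy, sum_congr rfl (g := fun _ => u 1) (fun z hz => ?_), sum_const,
        card_erase_of_mem hy, SimpleGraph.dist_self, hu.zero, nsmul_eq_mul,
        Nat.cast_sub (card_pos.2 ⟨x, hx⟩)]
      · push_cast; linarith
      · rw [mem_erase] at hz
        rw [SimpleGraph.dist_eq_one_iff_adj.2 (hcl hz.2 hy hz.1)]

end Regular

/-! ### Distances to a clique. -/

section Distance

variable {G : SimpleGraph V} {C : Finset V}

lemma exists_dist_eq_distTo (hC : C.Nonempty) (y : V) : ∃ z ∈ C, G.dist y z = distTo G C y := by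
  obtain ⟨z, hz⟩ := hC
  exact Nat.sInf_mem (s := {n : ℕ | ∃ z ∈ C, G.dist y z = n}) ⟨_, z, hz, rfl⟩

lemma distTo_le {z : V} (hz : z ∈ C) (y : V) : distTo G C y ≤ G.dist y z :=
  Nat.sInf_le ⟨z, hz, rfl⟩

lemma dist_le_distTo_add_one (hG : G.Connected) (hcl : G.IsClique (C : Set V)) {z : V}
    (hz : z ∈ C) (y : V) : G.dist y z ≤ distTo G C y + 1 := by
  obtain ⟨w, hw, hyw⟩ := exists_dist_eq_distTo (G := G) ⟨z, hz⟩ y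
  rw [← hyw]
  by_cases h : w = z
  · subst h; omega
  · have := hG.dist_triangle (u := y) (v := w) (w := z)
    rwa [SimpleGraph.dist_eq_one_iff_adj.2 (hcl hw hz h)] at this

lemma dist_le_dist_add_one (hG : G.Connected) {y w : V} (h : G.Adj y w) (z : V) :
    G.dist w z ≤ G.dist y z + 1 := by
  have := hG.dist_triangle (u := w) (v := y) (w := z)
  rw [SimpleGraph.dist_eq_one_iff_adj.2 h.symm] at this
  omega

lemma distTo_le_distTo_add_one (hG : G.Connected) (hC : C.Nonempty) {y w : V} (h : G.Adj y w) :
    distTo G C w ≤ distTo G C y + 1 := by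
  obtain ⟨z, hz, hyz⟩ := exists_dist_eq_distTo (G := G) hC y
  rw [← hyz]
  exact (distTo_le hz w).trans (dist_le_dist_add_one hG h z)

/-- All inequalities that confine a neighbour to few cells; later case analyses reduce to linear
arithmetic from these. -/
lemma nbrs_bounds (hG : G.Connected) (hcl : G.IsClique (C : Set V)) {x : V} (hx : x ∈ C) {z w : V}
    (hw : G.Adj z w) : distTo G C w ≤ distTo G C z + 1 ∧ distTo G C z ≤ distTo G C w + 1 ∧
      G.dist w x ≤ G.dist z x + 1 ∧ G.dist z x ≤ G.dist w x + 1 ∧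
      distTo G C w ≤ G.dist w x ∧ G.dist w x ≤ distTo G C w + 1 :=
  ⟨distTo_le_distTo_add_one hG ⟨x, hx⟩ hw, distTo_le_distTo_add_one hG ⟨x, hx⟩ hw.symm,
    dist_le_dist_add_one hG hw x, dist_le_dist_add_one hG hw.symm x, distTo_le hx w,
    dist_le_distTo_add_one hG hcl hx w⟩

end Distance

/-! ### Counting neighbours in sets. -/

section Neighbours

variable {G : SimpleGraph V} [DecidableRel G.Adj] {z : V} {S T U : Finset V}

lemma nbrs_congr (h : ∀ w, G.Adj z w → (w ∈ S ↔ w ∈ T)) : nbrs G z S = nbrs G z T := by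
  unfold nbrs
  congr 1
  ext w
  simp only [mem_filter, and_congr_left_iff]
  exact h w

lemma nbrs_eq_zero (h : ∀ w, G.Adj z w → w ∉ S) : nbrs G z S = 0 := by
  rw [nbrs, card_eq_zero, filter_eq_empty_iff]
  exact fun w hw hzw => h w hzw hw

lemma nbrs_eq_add (h : ∀ w, G.Adj z w → (w ∈ U ↔ w ∈ S ∨ w ∈ T))
    (h' : ∀ w, G.Adj z w → w ∈ S → w ∉ T) : nbrs G z U = nbrs G z S + nbrs G z T := by
  classical
  unfold nbrs
  rw [← card_union_of_disjoint]
  · congr 1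
    ext w
    by_cases hw : G.Adj z w
    · simp [h w hw, hw]
    · simp [hw]
  · rw [disjoint_left]
    intro w hw hw'
    rw [mem_filter] at hw hw'
    exact h' w hw.2 hw.1 hw'.1

lemma card_mul_nbrs_comm {a b : ℕ} (hS : ∀ z ∈ S, nbrs G z T = a) (hT : ∀ w ∈ T, nbrs G w S = b) :
    S.card * a = T.card * b := by
  refine card_mul_eq_card_mul G.Adj (fun z hz => hS z hz) fun w hw => ?_
  rw [← hT w hw, bipartiteBelow, nbrs]
  simp only [G.adj_comm]

end Neighbours

/-! ### Equitability of the layers around a Delsarte clique. -/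

section Regular

variable [Fintype V] [DecidableEq V] {G : SimpleGraph V} {p : ℕ → ℕ → ℕ → ℕ} {C : Finset V}
  {d : ℕ} {x z : V} {i : ℕ}

@[simp]
lemma mem_layer {V : Type*} [Fintype V] {G : SimpleGraph V} {C : Finset V} {i : ℕ} {y : V} : y ∈ layer G C i ↔ distTo G C y = i := by simp [layer]

@[simp]
lemma mem_cellMinus {y : V} :
    y ∈ cellMinus G C x i ↔ distTo G C y = i ∧ G.dist y x = i := by
  simp [cellMinus, SimpleGraph.dist_comm]

@[simp]
lemma mem_cellPlus {y : V} :
    y ∈ cellPlus G C x i ↔ distTo G C y = i ∧ G.dist y x = i + 1 := by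
  simp [cellPlus, SimpleGraph.dist_comm]

lemma IsDistanceRegularWith.nbrs_sphere [DecidableRel G.Adj] (hG : IsDistanceRegularWith G p)
    (x y : V) (j : ℕ) : nbrs G y (sphere G j x) = p (G.dist y x) 1 j := by
  rw [SimpleGraph.dist_comm, ← hG.card_filter_sphere, nbrs]
  congr 1
  ext w
  simp [SimpleGraph.dist_eq_one_iff_adj, and_comm]

lemma IsDistanceRegularWith.nbrs_univ [DecidableRel G.Adj] (hG : IsDistanceRegularWith G p)
    (y : V) : nbrs G y univ = p 0 1 1 := by
  rw [← hG.card_sphere y, nbrs]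
  congr 1
  ext w
  simp [SimpleGraph.dist_eq_one_iff_adj]

lemma cNum_pos (hG : IsDistanceRegularWith G p) {y : V} (h : G.dist y x = i + 1) :
    0 < cNum p (i + 1) := by
  classical
  rw [SimpleGraph.dist_comm] at h
  obtain ⟨w, hw, hw'⟩ := exists_adj_dist_eq hG.connected h
  rw [cNum, ← h, ← hG.card_filter_sphere, card_pos]
  exact ⟨w, by simp [SimpleGraph.dist_eq_one_iff_adj, hw, hw', h]⟩

/-- For adjacent `x, z` there is a vertex at distance `i` from `x` and `i + 1` from `z`, if
`i` is less than some distance in the graph. -/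
lemma exists_dist_eq_dist_eq (hG : IsDistanceRegularWith G p) {a b : V}
    (hi : i < G.dist a b) (hxz : G.Adj x z) :
    ∃ y, G.dist x y = i ∧ G.dist z y = i + 1 := by
  obtain ⟨w, hw, -⟩ := exists_dist_eq_of_le hG.connected (Nat.succ_le_of_lt hi)
  obtain ⟨a', ha', ha''⟩ := exists_dist_eq_of_le hG.connected (x := a) (y := w) (n := 1) (by omega)
  -- The adjacent pair `a', a` with witness `w` shows `p 1 i (i + 1) > 0`, which transfers to the
  -- pair `x, z`.
  have h1 := hG.card_inter a' a i (i + 1)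
  have h3 := hG.card_inter x z i (i + 1)
  rw [SimpleGraph.dist_eq_one_iff_adj.2 hxz] at h3
  rw [SimpleGraph.dist_comm, ha', ← h3] at h1
  have h2 : 0 < (sphere G i x ∩ sphere G (i + 1) z).card := by
    rw [← h1, card_pos]
    exact ⟨w, by simp [hw, ha'']⟩
  obtain ⟨y, hy⟩ := card_pos.1 h2
  exact ⟨y, by simpa using hy⟩

/-- A Delsarte clique has covering radius less than the diameter, and the number of vertices of
`C` nearest to `y` is positive, less than `|C|`, and depends only on the distance of `y` to `C`. -/
lemma IsDelsarteClique.exists_near [DecidableRel G.Adj] (hG : IsDistanceRegularWith G p)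
    (hdist : ∀ x y, G.dist x y ≤ d) (hC : IsDelsarteClique G C) (hcard : Nontrivial V) :
    ∃ N : ℕ → ℕ, ∀ y, distTo G C y < d ∧
      (C.filter (fun z => G.dist y z = distTo G C y)).card = N (distTo G C y) ∧
      0 < N (distTo G C y) ∧ N (distTo G C y) < C.card := by
  obtain ⟨hC1, u, hu, halt⟩ := hC.exists_cosines hG (D := d + 1)
    (fun x y => Nat.lt_succ_of_le (hdist x y)) hcard
  have hsum : ∀ y, ((C.filter (fun z => G.dist y z = distTo G C y)).card : ℝ) * u (distTo G C y) +
      ((C.card : ℝ) - (C.filter (fun z => G.dist y z = distTo G C y)).card) *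
        u (distTo G C y + 1) = 0 := by
    intro y
    rw [← hu y, ← sum_filter_add_sum_filter_not C (fun z => G.dist y z = distTo G C y)]
    congr 1
    · rw [sum_congr rfl (g := fun _ => u (distTo G C y))
        (fun z hz => by rw [(mem_filter.1 hz).2]), sum_const, nsmul_eq_mul]
    · rw [sum_congr rfl (g := fun _ => u (distTo G C y + 1)), sum_const, nsmul_eq_mul,
        ← card_filter_add_card_filter_not (s := C) (fun z => G.dist y z = distTo G C y)]
      · push_cast; ring
      · intro z hz
        rw [mem_filter] at hz
        have h1 := dist_le_distTo_add_one hG.connected hC.2.1 hz.1 y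
        have h2 := distTo_le (G := G) hz.1 y
        rw [show G.dist y z = distTo G C y + 1 by omega]
  have hnear : ∀ y, 0 < (-1) ^ distTo G C y * u (distTo G C y) ∧
      0 < (C.filter (fun z => G.dist y z = distTo G C y)).card := by
    intro y
    obtain ⟨z, hz, hyz⟩ := exists_dist_eq_distTo (G := G) hC.1 y
    refine ⟨hyz ▸ halt y z, card_pos.2 ⟨z, by simp [hz, hyz]⟩⟩
  have hlt : ∀ y, (C.filter (fun z => G.dist y z = distTo G C y)).card < C.card := by
    intro y
    refine lt_of_le_of_ne (card_filter_le _ _) fun h => ?_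
    have h1 := hsum y
    rw [h, sub_self, zero_mul, add_zero] at h1
    have h2 : (C.card : ℝ) ≠ 0 := by exact_mod_cast (by omega : C.card ≠ 0)
    have := (hnear y).1
    rw [(mul_eq_zero.1 h1).resolve_left h2] at this
    simp at this
  have hfar : ∀ y, ∃ z ∈ C, G.dist y z = distTo G C y + 1 := by
    intro y
    by_contra! h
    refine (hlt y).ne (congrArg card (filter_true_of_mem fun z hz => ?_))
    have h1 := dist_le_distTo_add_one hG.connected hC.2.1 hz y
    have h2 := distTo_le (G := G) hz y
    have := h z hz
    omega
  have hunique : ∀ y y', distTo G C y = distTo G C y' →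
      (C.filter (fun z => G.dist y z = distTo G C y)).card =
      (C.filter (fun z => G.dist y' z = distTo G C y')).card := by
    intro y y' h
    obtain ⟨z, -, hz⟩ := hfar y
    have h1 := halt y z
    rw [hz, pow_succ] at h1
    have h2 := (hnear y).1
    -- Consecutive cosines have opposite signs, so the linear relation in `hsum` has a unique
    -- solution.
    have hne : u (distTo G C y) - u (distTo G C y + 1) ≠ 0 := by
      intro h0
      have : u (distTo G C y) = u (distTo G C y + 1) := by linarith
      rw [← this] at h1
      linarith
    have h3 := hsum y
    have h4 := hsum y'
    rw [← h] at h4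
    rw [← h]
    have h5 := mul_right_cancel₀ hne (by linarith : ((C.filter
      (fun z => G.dist y z = distTo G C y)).card : ℝ) * (u (distTo G C y) - u (distTo G C y + 1)) =
      ((C.filter (fun z => G.dist y' z = distTo G C y)).card : ℝ) *
        (u (distTo G C y) - u (distTo G C y + 1)))
    exact_mod_cast h5
  classical
  refine ⟨fun i => if h : ∃ y, distTo G C y = i then
    (C.filter (fun z => G.dist h.choose z = distTo G C h.choose)).card else 0, fun y => ?_⟩
  have hex : ∃ y', distTo G C y' = distTo G C y := ⟨y, rfl⟩
  obtain ⟨z, -, hz⟩ := hfar y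
  have hN := hunique hex.choose y hex.choose_spec
  refine ⟨by have := hdist y z; omega, ?_⟩
  simp only [dif_pos hex, hN]
  exact ⟨trivial, (hnear y).2, hlt y⟩

/-- Double counting the pairs of a neighbour of `z` in the previous layer and a nearest vertex
in `C`. -/
lemma near_mul_nbrs_pred [DecidableRel G.Adj] (hG : IsDistanceRegularWith G p) (hC : C.Nonempty)
    {N : ℕ → ℕ}
    (hN : ∀ y, (C.filter (fun z => G.dist y z = distTo G C y)).card = N (distTo G C y))
    (hz : z ∈ layer G C (i + 1)) :
    N i * nbrs G z (layer G C i) = N (i + 1) * cNum p (i + 1) := by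
  rw [mem_layer] at hz
  calc N i * nbrs G z (layer G C i)
      = ∑ w ∈ (layer G C i).filter (G.Adj z), ∑ u ∈ C, if G.dist w u = i then 1 else 0 := by
        rw [nbrs, mul_comm, ← smul_eq_mul, ← sum_const]
        refine sum_congr rfl fun w hw => ?_
        rw [mem_filter, mem_layer] at hw
        rw [← card_filter, ← hw.1, hN]
    _ = ∑ u ∈ C, ∑ w ∈ (layer G C i).filter (G.Adj z), if G.dist w u = i then 1 else 0 := sum_comm
    _ = ∑ u ∈ C, if G.dist z u = i + 1 then cNum p (i + 1) else 0 := by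
        refine sum_congr rfl fun u hu => ?_
        -- A neighbour of `z` at distance `i` from `u ∈ C` lies in layer `i` automatically.
        have h1 : ∑ w ∈ (layer G C i).filter (G.Adj z), (if G.dist w u = i then 1 else 0) =
            nbrs G z (sphere G i u) := by
          rw [← card_filter, nbrs]
          congr 1
          ext w
          simp only [mem_filter, mem_layer, mem_sphere, G.dist_comm (u := w)]
          refine ⟨fun h => ⟨h.2, h.1.2⟩, fun h => ⟨⟨?_, h.2⟩, h.1⟩⟩
          have h1 := distTo_le (G := G) hu w
          have h2 := distTo_le_distTo_add_one hG.connected hC h.2.symm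
          rw [SimpleGraph.dist_comm, h.1] at h1
          omega
        rw [h1]
        split_ifs with h
        · rw [hG.nbrs_sphere, h, cNum, Nat.add_sub_cancel]
        · refine nbrs_eq_zero fun w hw hw' => h ?_
          rw [mem_sphere, SimpleGraph.dist_comm] at hw'
          have h2 := dist_le_dist_add_one hG.connected hw.symm u
          have h3 := distTo_le (G := G) hu z
          omega
    _ = _ := by
        rw [← hz, ← hN z, ← sum_filter, sum_const, smul_eq_mul]

/-- Double counting the pairs of a neighbour of `z` in the next layer and a non-nearest vertex
in `C`. -/
lemma far_mul_nbrs_succ [DecidableRel G.Adj] (hG : IsDistanceRegularWith G p) (hC : C.Nonempty)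
    (hcl : G.IsClique (C : Set V)) {N : ℕ → ℕ}
    (hN : ∀ y, (C.filter (fun z => G.dist y z = distTo G C y)).card = N (distTo G C y))
    (hz : z ∈ layer G C i) :
    (C.card - N (i + 1)) * nbrs G z (layer G C (i + 1)) =
      (C.card - N i) * bNum p (i + 1) := by
  rw [mem_layer] at hz
  have hfar : ∀ y, (C.filter (fun u => G.dist y u = distTo G C y + 1)).card =
      C.card - N (distTo G C y) := by
    intro y
    rw [← hN, ← card_filter_add_card_filter_not (s := C) (fun z => G.dist y z = distTo G C y),
      Nat.add_sub_cancel_left]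
    congr 1
    refine filter_congr fun u hu => ?_
    have h1 := dist_le_distTo_add_one hG.connected hcl hu y
    have h2 := distTo_le (G := G) hu y
    omega
  calc (C.card - N (i + 1)) * nbrs G z (layer G C (i + 1))
      = ∑ w ∈ (layer G C (i + 1)).filter (G.Adj z),
          ∑ u ∈ C, if G.dist w u = i + 1 + 1 then 1 else 0 := by
        rw [nbrs, mul_comm, ← smul_eq_mul, ← sum_const]
        refine sum_congr rfl fun w hw => ?_
        rw [mem_filter, mem_layer] at hw
        rw [← card_filter, ← hw.1, hfar]
    _ = ∑ u ∈ C, ∑ w ∈ (layer G C (i + 1)).filter (G.Adj z),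
          if G.dist w u = i + 1 + 1 then 1 else 0 := sum_comm
    _ = ∑ u ∈ C, if G.dist z u = i + 1 then bNum p (i + 1) else 0 := by
        refine sum_congr rfl fun u hu => ?_
        -- A neighbour of `z` at distance `i + 2` from `u ∈ C` lies in layer `i + 1` automatically.
        have h1 : ∑ w ∈ (layer G C (i + 1)).filter (G.Adj z),
            (if G.dist w u = i + 1 + 1 then 1 else 0) = nbrs G z (sphere G (i + 1 + 1) u) := by
          rw [← card_filter, nbrs]
          congr 1
          ext w
          simp only [mem_filter, mem_layer, mem_sphere, G.dist_comm (u := w)]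
          refine ⟨fun h => ⟨h.2, h.1.2⟩, fun h => ⟨⟨?_, h.2⟩, h.1⟩⟩
          have h1 := dist_le_distTo_add_one hG.connected hcl hu w
          have h2 := distTo_le_distTo_add_one hG.connected hC h.2
          rw [SimpleGraph.dist_comm, h.1] at h1
          omega
        rw [h1]
        split_ifs with h
        · rw [hG.nbrs_sphere, h, bNum]
        · refine nbrs_eq_zero fun w hw hw' => h ?_
          rw [mem_sphere, SimpleGraph.dist_comm] at hw'
          have h2 := dist_le_dist_add_one hG.connected hw u
          have h3 := dist_le_distTo_add_one hG.connected hcl hu z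
          omega
    _ = _ := by
        rw [← hz, ← hfar z, ← sum_filter, sum_const, smul_eq_mul]

lemma nbrs_univ_eq_layers [DecidableRel G.Adj] (hG : G.Connected) (hC : C.Nonempty)
    (z : V) (hz : z ∈ layer G C i) :
    nbrs G z univ = (if i = 0 then 0 else nbrs G z (layer G C (i - 1))) +
      nbrs G z (layer G C i) + nbrs G z (layer G C (i + 1)) := by
  rw [mem_layer] at hz
  have key : ∀ w, G.Adj z w → distTo G C w ≤ i + 1 ∧ i ≤ distTo G C w + 1 := fun w hw =>
    ⟨hz ▸ distTo_le_distTo_add_one hG hC hw, hz ▸ distTo_le_distTo_add_one hG hC hw.symm⟩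
  rw [nbrs_eq_add (S := univ.filter (fun w => distTo G C w ≤ i)) (T := layer G C (i + 1))]
  · congr 1
    split_ifs with h
    · rw [zero_add]
      refine nbrs_congr fun w hw => ?_
      simp only [mem_filter, mem_univ, true_and, mem_layer]
      omega
    · refine nbrs_eq_add (fun w hw => ?_) (fun w hw => ?_)
      · have := key w hw
        simp only [mem_filter, mem_univ, true_and, mem_layer]
        omega
      · simp only [mem_layer]
        omega
  · intro w hw
    have := key w hw
    simp only [mem_filter, mem_univ, true_and, true_iff, mem_layer]
    omega
  · intro w _ h1 h2
    simp only [mem_filter, mem_univ, true_and, mem_layer] at h1 h2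
    omega

/-- The two double counts determine the counts in the adjacent layers after division by `N i` or
`C.card - N (i + 1)`; the valency `p 0 1 1` then gives the count within a layer. -/
lemma IsDelsarteClique.exists_isLayerNumbers [DecidableRel G.Adj]
    (hG : IsDistanceRegularWith G p) (hdist : ∀ x y, G.dist x y ≤ d) (hC : IsDelsarteClique G C)
    (hcard : Nontrivial V) :
    ∃ ta tb tc : ℕ → ℕ, IsLayerNumbers G C d ta tb tc ∧
      ∀ y, 0 < distTo G C y → 0 < tc (distTo G C y) := by
  obtain ⟨N, hN⟩ := hC.exists_near hG hdist hcard
  have hN1 := fun y => (hN y).2.1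
  have hcpos : ∀ y, ∀ i, distTo G C y = i + 1 → 0 < cNum p (i + 1) := by
    intro y i h
    obtain ⟨z, -, hz⟩ := exists_dist_eq_distTo (G := G) hC.1 y
    exact cNum_pos hG (hz.trans h)
  have hpred : ∀ y i, distTo G C y = i + 1 → 0 < N i ∧
      nbrs G y (layer G C i) = N (i + 1) * cNum p (i + 1) / N i := by
    intro y i h
    have h1 := near_mul_nbrs_pred hG hC.1 hN1 (mem_layer.2 h)
    have h2 : 0 < N (i + 1) * cNum p (i + 1) :=
      Nat.mul_pos (h ▸ (hN y).2.2.1) (hcpos y i h)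
    rw [← h1] at h2
    have h3 := Nat.pos_of_mul_pos_right h2
    exact ⟨h3, by rw [← h1, Nat.mul_div_cancel_left _ h3]⟩
  set tc : ℕ → ℕ := fun i => if i = 0 then 0 else N i * cNum p i / N (i - 1)
  -- The bound `N (i + 1) < C.card` is known only if layer `i + 1` is nonempty; otherwise the count
  -- is `0`.
  set tb : ℕ → ℕ := fun i => if ∃ w, distTo G C w = i + 1 then
    (C.card - N i) * bNum p (i + 1) / (C.card - N (i + 1)) else 0
  have hc : ∀ i, ∀ z ∈ layer G C (i + 1), nbrs G z (layer G C i) = tc (i + 1) := by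
    intro i z hz
    simpa [tc] using (hpred z i (mem_layer.1 hz)).2
  have hb : ∀ i, ∀ z ∈ layer G C i, nbrs G z (layer G C (i + 1)) = tb i := by
    intro i z hz
    by_cases h : ∃ w, distTo G C w = i + 1
    · simp only [tb, if_pos h]
      obtain ⟨w, hw⟩ := h
      have h1 : 0 < C.card - N (i + 1) := by
        have := (hN w).2.2.2
        rw [hw] at this
        omega
      rw [← far_mul_nbrs_succ hG hC.1 hC.2.1 hN1 hz, Nat.mul_div_cancel_left _ h1]
    · simp only [tb, if_neg h]
      exact nbrs_eq_zero fun w _ hw => h ⟨w, mem_layer.1 hw⟩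
  refine ⟨fun i => p 0 1 1 - tc i - tb i, tb, tc,
    ⟨by simp [tc], fun i _ => hc i, fun i _ z hz => ?_, fun i _ => hb i⟩, fun y hy => ?_⟩
  · have h1 := nbrs_univ_eq_layers hG.connected hC.1 z hz
    rw [hG.nbrs_univ, hb i z hz] at h1
    cases i with
    | zero =>
      simp only [if_pos, zero_add] at h1
      simp [tc, h1]
    | succ i =>
      simp only [Nat.add_eq_zero_iff, one_ne_zero, and_false, if_false, Nat.add_sub_cancel,
        hc i z hz] at h1
      rw [h1]
      omega
  · obtain ⟨i, hi⟩ := Nat.exists_eq_succ_of_ne_zero hy.ne'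
    obtain ⟨z, hz, hyz⟩ := exists_dist_eq_distTo (G := G) hC.1 y
    obtain ⟨w, hw, hw'⟩ := exists_adj_dist_eq hG.connected
      ((G.dist_comm).trans (hyz.trans hi))
    rw [hi, Nat.succ_eq_add_one, ← hc i y (mem_layer.2 hi), nbrs, card_pos]
    refine ⟨w, mem_filter.2 ⟨mem_layer.2 ?_, hw⟩⟩
    have h1 := distTo_le (G := G) hz w
    have h2 := distTo_le_distTo_add_one hG.connected hC.1 hw.symm
    rw [G.dist_comm, hw'] at h1
    omega

/-! ### The cells: partition, neighbour counts and sizes. -/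

lemma isPartition_cells (hG : IsDistanceRegularWith G p) (hcl : G.IsClique (C : Set V))
    (hC : 1 < C.card) (hx : x ∈ C) (hrad : ∀ y, distTo G C y < d) {a b : V}
    (hab : G.dist a b = d) : IsPartition (cells G C x d) := by
  refine ⟨?_, ?_, fun y => ?_⟩
  · obtain ⟨z, hz, hzx⟩ := exists_mem_ne hC x
    -- A vertex at distances `i` and `i + 1` from two vertices of `C` is in layer `i`; the sign of
    -- its cell tells whether `x` is the nearer one.
    have hadj : G.Adj x z := hcl hx hz hzx.symm
    rintro ⟨⟨i, hi⟩, _ | _⟩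
    · obtain ⟨y, h1, h2⟩ := exists_dist_eq_dist_eq hG (hab ▸ hi) hadj
      rw [G.dist_comm] at h1 h2
      refine ⟨y, mem_cellMinus.2 ⟨?_, h1⟩⟩
      change distTo G C y = i
      have h3 := distTo_le (G := G) hx y
      have h4 := dist_le_distTo_add_one hG.connected hcl hz y
      omega
    · obtain ⟨y, h1, h2⟩ := exists_dist_eq_dist_eq hG (hab ▸ hi) hadj.symm
      rw [G.dist_comm] at h1 h2
      refine ⟨y, mem_cellPlus.2 ⟨?_, h2⟩⟩
      change distTo G C y = i
      have h3 := distTo_le (G := G) hz y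
      have h4 := dist_le_distTo_add_one hG.connected hcl hx y
      omega
  · rintro ⟨⟨i, hi⟩, _ | _⟩ ⟨⟨j, hj⟩, _ | _⟩ hne <;> rw [disjoint_left] <;> intro y hy hy' <;>
      simp only [cells, mem_cellMinus, mem_cellPlus] at hy hy' <;>
      simp only [ne_eq, Prod.mk.injEq, Fin.mk.injEq, and_true] at hne <;> omega
  · have h1 := distTo_le (G := G) hx y
    have h2 := dist_le_distTo_add_one hG.connected hcl hx y
    by_cases h : G.dist y x = distTo G C y
    · exact ⟨(⟨_, hrad y⟩, false), mem_cellMinus.2 ⟨rfl, h⟩⟩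
    · exact ⟨(⟨_, hrad y⟩, true), mem_cellPlus.2 ⟨rfl, by dsimp only; omega⟩⟩

variable [DecidableRel G.Adj] {ta tb tc : ℕ → ℕ}

/-- Among neighbours of `z`, sphere `i - 1` is `C_{i-1}^-` and layer `i + 1` is `C_{i+1}^-`. The
remaining counts come from splitting layer `i - 1` into `C_{i-1}^±`, sphere `i` into `C_i^-` and
`C_{i-1}^+`, and sphere `i + 1` into `C_i^+` and `C_{i+1}^-`. -/
lemma nbrs_of_mem_cellMinus (hG : IsDistanceRegularWith G p) (hcl : G.IsClique (C : Set V))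
    (hx : x ∈ C) (hL : IsLayerNumbers G C d ta tb tc) (hi : i < d) (hz : z ∈ cellMinus G C x i) :
    (∀ j, j + 1 = i → nbrs G z (cellMinus G C x j) = cNum p i ∧
      (nbrs G z (cellPlus G C x j) : ℤ) = (tc i : ℤ) - cNum p i) ∧
    (nbrs G z (cellMinus G C x i) : ℤ) = (aNum p i : ℤ) - tc i + cNum p i ∧
    (nbrs G z (cellPlus G C x i) : ℤ) = (bNum p i : ℤ) - tb i ∧
    nbrs G z (cellMinus G C x (i + 1)) = tb i ∧
    nbrs G z (cellPlus G C x (i + 1)) = 0 ∧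
    (∀ j, j + 1 ≠ i → j ≠ i → j ≠ i + 1 →
      nbrs G z (cellMinus G C x j) = 0 ∧ nbrs G z (cellPlus G C x j) = 0) := by
  have hb := hL.b_eq i hi z (mem_layer.2 (mem_cellMinus.1 hz).1)
  have hcl' := hL.c_succ
  rw [mem_cellMinus] at hz
  have key : ∀ w, G.Adj z w → _ := fun w hw => nbrs_bounds hG.connected hcl hx hw
  rw [hz.1, hz.2] at key
  have hs : ∀ j, nbrs G z (sphere G j x) = p i 1 j := fun j => by rw [hG.nbrs_sphere, hz.2]
  have hb1 : nbrs G z (cellMinus G C x (i + 1)) = tb i := by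
    rw [← hb]
    refine nbrs_congr fun w hw => ?_
    have := key w hw
    simp only [mem_cellMinus, mem_layer]
    omega
  have hb2 : bNum p i = nbrs G z (cellPlus G C x i) + tb i := by
    rw [bNum, ← hs, ← hb1]
    refine nbrs_eq_add (fun w hw => ?_) fun w hw => ?_ <;> have := key w hw <;>
      simp only [mem_sphere, mem_cellMinus, mem_cellPlus, G.dist_comm (u := x)] <;> omega
  have hc1 : ∀ j, j + 1 = i → nbrs G z (cellMinus G C x j) = cNum p i := by
    rintro j rfl
    rw [cNum, ← hs]
    refine nbrs_congr fun w hw => ?_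
    have := key w hw
    simp only [mem_cellMinus, mem_sphere, G.dist_comm (u := x)]
    omega
  have hc2 : ∀ j, j + 1 = i → tc i = nbrs G z (cellPlus G C x j) + cNum p i := by
    intro j hj
    rw [← hc1 j hj]
    subst hj
    rw [← hL.c_succ j hi z (mem_layer.2 hz.1)]
    refine nbrs_eq_add (fun w hw => ?_) fun w hw => ?_ <;> have := key w hw <;>
      simp only [mem_layer, mem_cellMinus, mem_cellPlus] <;> omega
  have ha : (nbrs G z (cellMinus G C x i) : ℤ) = (aNum p i : ℤ) - tc i + cNum p i := by
    cases i with
    | zero =>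
      have h1 : nbrs G z (cellMinus G C x 0) = aNum p 0 := by
        rw [aNum, ← hs]
        refine nbrs_congr fun w hw => ?_
        have := key w hw
        simp only [mem_cellMinus, mem_sphere, G.dist_comm (u := x)]
        omega
      -- By truncated subtraction `cNum p 0` is `p 0 1 0`, the number of neighbours of `x` equal to
      -- `x`.
      have h2 : cNum p 0 = 0 := by
        rw [cNum, ← hs]
        refine nbrs_eq_zero fun w hw => ?_
        rw [mem_sphere, hG.connected.dist_eq_zero_iff]
        rintro rfl
        exact hw.ne (hG.connected.dist_eq_zero_iff.1 hz.2)
      rw [h1, h2, hL.c_zero]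
      simp
    | succ j =>
      have h1 : aNum p (j + 1) =
          nbrs G z (cellMinus G C x (j + 1)) + nbrs G z (cellPlus G C x j) := by
        rw [aNum, ← hs]
        refine nbrs_eq_add (fun w hw => ?_) fun w hw => ?_ <;> have := key w hw <;>
          simp only [mem_sphere, mem_cellMinus, mem_cellPlus, G.dist_comm (u := x)] <;> omega
      have := hc2 j rfl
      omega
  refine ⟨fun j hj => ⟨hc1 j hj, by have := hc2 j hj; omega⟩, ha, by omega, hb1,
    nbrs_eq_zero fun w hw => ?_, fun j h1 h2 h3 => ⟨nbrs_eq_zero fun w hw => ?_,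
      nbrs_eq_zero fun w hw => ?_⟩⟩ <;> have := key w hw <;>
    simp only [mem_cellMinus, mem_cellPlus] <;> omega

/-- Here, among neighbours of `z`, sphere `i + 2` is `C_{i+1}^+` and layer `i - 1` is `C_{i-1}^+`.
Layers `i` and `i + 1` split by sign, and sphere `i` splits into `C_i^-` and `C_{i-1}^+`. -/
lemma nbrs_of_mem_cellPlus (hG : IsDistanceRegularWith G p) (hcl : G.IsClique (C : Set V))
    (hx : x ∈ C) (hL : IsLayerNumbers G C d ta tb tc) (hi : i < d) (hz : z ∈ cellPlus G C x i) :
    (∀ j, j + 1 = i → nbrs G z (cellMinus G C x j) = 0 ∧ nbrs G z (cellPlus G C x j) = tc i) ∧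
    (nbrs G z (cellMinus G C x i) : ℤ) = (cNum p (i + 1) : ℤ) - tc i ∧
    (nbrs G z (cellPlus G C x i) : ℤ) = (ta i : ℤ) - cNum p (i + 1) + tc i ∧
    (nbrs G z (cellMinus G C x (i + 1)) : ℤ) = (tb i : ℤ) - bNum p (i + 1) ∧
    nbrs G z (cellPlus G C x (i + 1)) = bNum p (i + 1) ∧
    (∀ j, j + 1 ≠ i → j ≠ i → j ≠ i + 1 →
      nbrs G z (cellMinus G C x j) = 0 ∧ nbrs G z (cellPlus G C x j) = 0) := by
  have ha := hL.a_eq i hi z (mem_layer.2 (mem_cellPlus.1 hz).1)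
  have hb := hL.b_eq i hi z (mem_layer.2 (mem_cellPlus.1 hz).1)
  rw [mem_cellPlus] at hz
  have key : ∀ w, G.Adj z w → _ := fun w hw => nbrs_bounds hG.connected hcl hx hw
  rw [hz.1, hz.2] at key
  have hs : ∀ j, nbrs G z (sphere G j x) = p (i + 1) 1 j := fun j => by
    rw [hG.nbrs_sphere, hz.2]
  have hb1 : nbrs G z (cellPlus G C x (i + 1)) = bNum p (i + 1) := by
    rw [bNum, ← hs]
    refine nbrs_congr fun w hw => ?_
    have := key w hw
    simp only [mem_cellPlus, mem_sphere, G.dist_comm (u := x)]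
    omega
  have hb2 : tb i = nbrs G z (cellMinus G C x (i + 1)) + bNum p (i + 1) := by
    rw [← hb, ← hb1]
    refine nbrs_eq_add (fun w hw => ?_) fun w hw => ?_ <;> have := key w hw <;>
      simp only [mem_layer, mem_cellMinus, mem_cellPlus] <;> omega
  have hc1 : ∀ j, j + 1 = i → nbrs G z (cellPlus G C x j) = tc i := by
    rintro j rfl
    rw [← hL.c_succ j hi z (mem_layer.2 hz.1)]
    refine nbrs_congr fun w hw => ?_
    have := key w hw
    simp only [mem_cellPlus, mem_layer]
    omega
  have hc2 : cNum p (i + 1) = nbrs G z (cellMinus G C x i) + tc i := by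
    rw [cNum, ← hs]
    cases i with
    | zero =>
      rw [hL.c_zero, add_zero]
      refine nbrs_congr fun w hw => ?_
      have := key w hw
      simp only [mem_cellMinus, mem_sphere, G.dist_comm (u := x)]
      omega
    | succ j =>
      rw [← hc1 j rfl]
      refine nbrs_eq_add (fun w hw => ?_) fun w hw => ?_ <;> have := key w hw <;>
        simp only [mem_sphere, mem_cellMinus, mem_cellPlus, G.dist_comm (u := x)] <;> omega
  have ha1 : ta i = nbrs G z (cellMinus G C x i) + nbrs G z (cellPlus G C x i) := by
    rw [← ha]
    refine nbrs_eq_add (fun w hw => ?_) fun w hw => ?_ <;> have := key w hw <;>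
      simp only [mem_layer, mem_cellMinus, mem_cellPlus] <;> omega
  refine ⟨fun j hj => ⟨nbrs_eq_zero fun w hw => ?_, hc1 j hj⟩, by omega, by omega, by omega, hb1,
    fun j h1 h2 h3 => ⟨nbrs_eq_zero fun w hw => ?_, nbrs_eq_zero fun w hw => ?_⟩⟩ <;>
    have := key w hw <;> simp only [mem_cellMinus, mem_cellPlus] <;> omega

lemma equitable_cells (hG : IsDistanceRegularWith G p) (hcl : G.IsClique (C : Set V))
    (hx : x ∈ C) (hL : IsLayerNumbers G C d ta tb tc) (s t : Fin d × Bool) {u v : V}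
    (hu : u ∈ cells G C x d s) (hv : v ∈ cells G C x d s) :
    nbrs G u (cells G C x d t) = nbrs G v (cells G C x d t) := by
  obtain ⟨⟨i, hi⟩, bs⟩ := s
  obtain ⟨⟨j, hj⟩, bt⟩ := t
  cases bs
  · obtain ⟨h1, h2, h3, h4, h5, h6⟩ := nbrs_of_mem_cellMinus hG hcl hx hL hi hu
    obtain ⟨g1, g2, g3, g4, g5, g6⟩ := nbrs_of_mem_cellMinus hG hcl hx hL hi hv
    by_cases e1 : j + 1 = i
    · have h := h1 j e1
      have g := g1 j e1
      cases bt <;> simp only [cells] <;> omega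
    by_cases e2 : j = i
    · subst e2
      cases bt <;> simp only [cells] <;> omega
    by_cases e3 : j = i + 1
    · subst e3
      cases bt <;> simp only [cells] <;> omega
    have h := h6 j e1 e2 e3
    have g := g6 j e1 e2 e3
    cases bt <;> simp only [cells] <;> omega
  · obtain ⟨h1, h2, h3, h4, h5, h6⟩ := nbrs_of_mem_cellPlus hG hcl hx hL hi hu
    obtain ⟨g1, g2, g3, g4, g5, g6⟩ := nbrs_of_mem_cellPlus hG hcl hx hL hi hv
    by_cases e1 : j + 1 = i
    · have h := h1 j e1
      have g := g1 j e1
      cases bt <;> simp only [cells] <;> omega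
    by_cases e2 : j = i
    · subst e2
      cases bt <;> simp only [cells] <;> omega
    by_cases e3 : j = i + 1
    · subst e3
      cases bt <;> simp only [cells] <;> omega
    have h := h6 j e1 e2 e3
    have g := g6 j e1 e2 e3
    cases bt <;> simp only [cells] <;> omega

/-- Count edges between `C_i^-` and `C_{i+1}^-` from both ends, starting from `C_0^- = {x}`. -/
lemma card_cellMinus (hG : IsDistanceRegularWith G p) (hcl : G.IsClique (C : Set V))
    (hx : x ∈ C) (hL : IsLayerNumbers G C d ta tb tc)
    (hc : ∀ j, j + 1 < d → 0 < cNum p (j + 1)) (hi : i < d) :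
    ((cellMinus G C x i).card : ℚ) =
      (∏ j ∈ range i, (tb j : ℚ)) / (∏ j ∈ range i, (cNum p (j + 1) : ℚ)) := by
  induction i with
  | zero =>
    have : cellMinus G C x 0 = {x} := by
      ext y
      simp only [mem_cellMinus, mem_singleton, hG.connected.dist_eq_zero_iff]
      refine ⟨fun h => h.2, ?_⟩
      rintro rfl
      exact ⟨Nat.le_zero.1 ((distTo_le hx y).trans_eq (by simp)), rfl⟩
    simp [this]
  | succ i ih =>
    have h1 : (cellMinus G C x i).card * tb i = (cellMinus G C x (i + 1)).card * cNum p (i + 1) :=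
      card_mul_nbrs_comm
        (fun z hz => (nbrs_of_mem_cellMinus hG hcl hx hL (by omega) hz).2.2.2.1)
        (fun z hz => ((nbrs_of_mem_cellMinus hG hcl hx hL hi hz).1 i rfl).1)
    have h2 : (cNum p (i + 1) : ℚ) ≠ 0 := by exact_mod_cast (hc i hi).ne'
    rw [prod_range_succ, prod_range_succ, mul_div_mul_comm, ← ih (by omega), ← mul_div_assoc,
      eq_div_iff h2]
    exact_mod_cast h1.symm

/-- The same edge count between consecutive plus cells, starting from `C_0^+ = C \ {x}`. -/
lemma card_cellPlus (hG : IsDistanceRegularWith G p) (hcl : G.IsClique (C : Set V))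
    (hx : x ∈ C) (hL : IsLayerNumbers G C d ta tb tc)
    (hc : ∀ j, j + 1 < d → 0 < tc (j + 1)) (hi : i < d) :
    ((cellPlus G C x i).card : ℚ) =
      (∏ j ∈ range i, (bNum p (j + 1) : ℚ)) / (∏ j ∈ range i, (tc (j + 1) : ℚ)) *
        ((C.card : ℚ) - 1) := by
  induction i with
  | zero =>
    have : cellPlus G C x 0 = C.erase x := by
      ext y
      simp only [mem_cellPlus, mem_erase, zero_add, SimpleGraph.dist_eq_one_iff_adj]
      constructor
      · rintro ⟨h1, h2⟩
        obtain ⟨z, hz, hyz⟩ := exists_dist_eq_distTo (G := G) ⟨x, hx⟩ y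
        rw [h1, hG.connected.dist_eq_zero_iff] at hyz
        exact ⟨h2.ne, hyz ▸ hz⟩
      · rintro ⟨h1, h2⟩
        exact ⟨Nat.le_zero.1 ((distTo_le h2 y).trans_eq (by simp)), hcl h2 hx h1⟩
    rw [this, card_erase_of_mem hx, Nat.cast_sub (card_pos.2 ⟨x, hx⟩)]
    simp
  | succ i ih =>
    have h1 : (cellPlus G C x i).card * bNum p (i + 1) =
        (cellPlus G C x (i + 1)).card * tc (i + 1) :=
      card_mul_nbrs_comm
        (fun z hz => (nbrs_of_mem_cellPlus hG hcl hx hL (by omega) hz).2.2.2.2.1)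
        (fun z hz => ((nbrs_of_mem_cellPlus hG hcl hx hL hi hz).1 i rfl).2)
    have h2 : (tc (i + 1) : ℚ) ≠ 0 := by exact_mod_cast (hc i hi).ne'
    rw [prod_range_succ, prod_range_succ, mul_div_mul_comm, mul_right_comm, ← ih (by omega),
      ← mul_div_assoc, eq_div_iff h2]
    exact_mod_cast h1.symm

end Regular

end DelsarteClique

theorem proposition5p8 {V : Type*} [Fintype V] [DecidableEq V] (G : SimpleGraph V)
    [DecidableRel G.Adj] (d : ℕ) (hd : G.diam = d) (hd3 : 3 ≤ d)
    (p : ℕ → ℕ → ℕ → ℕ) (hG : DelsarteClique.IsDistanceRegularWith G p)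
    (C : Finset V) (hC : DelsarteClique.IsDelsarteClique G C) (x : V) (hx : x ∈ C) :
    DelsarteClique.IsEquitablePartition G (DelsarteClique.cells G C x d) ∧
    ∃ ta tb tc : ℕ → ℕ, DelsarteClique.IsLayerNumbers G C d ta tb tc ∧
      -- cardinalities of the cells
      (∀ i, i < d →
        ((DelsarteClique.cellMinus G C x i).card : ℚ) =
            (∏ j ∈ Finset.range i, (tb j : ℚ)) /
              (∏ j ∈ Finset.range i, (DelsarteClique.cNum p (j + 1) : ℚ)) ∧
        ((DelsarteClique.cellPlus G C x i).card : ℚ) =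
            (∏ j ∈ Finset.range i, (DelsarteClique.bNum p (j + 1) : ℚ)) /
              (∏ j ∈ Finset.range i, (tc (j + 1) : ℚ)) * ((C.card : ℚ) - 1)) ∧
      -- neighbours of a vertex of `C_i^-`
      (∀ i, i < d → ∀ z ∈ DelsarteClique.cellMinus G C x i,
        (∀ j, j + 1 = i →
          DelsarteClique.nbrs G z (DelsarteClique.cellMinus G C x j) = DelsarteClique.cNum p i ∧
          (DelsarteClique.nbrs G z (DelsarteClique.cellPlus G C x j) : ℤ) =
            (tc i : ℤ) - DelsarteClique.cNum p i) ∧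
        (DelsarteClique.nbrs G z (DelsarteClique.cellMinus G C x i) : ℤ) =
          (DelsarteClique.aNum p i : ℤ) - tc i + DelsarteClique.cNum p i ∧
        (DelsarteClique.nbrs G z (DelsarteClique.cellPlus G C x i) : ℤ) =
          (DelsarteClique.bNum p i : ℤ) - tb i ∧
        DelsarteClique.nbrs G z (DelsarteClique.cellMinus G C x (i + 1)) = tb i ∧
        DelsarteClique.nbrs G z (DelsarteClique.cellPlus G C x (i + 1)) = 0 ∧
        (∀ j, j + 1 ≠ i → j ≠ i → j ≠ i + 1 →
          DelsarteClique.nbrs G z (DelsarteClique.cellMinus G C x j) = 0 ∧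
          DelsarteClique.nbrs G z (DelsarteClique.cellPlus G C x j) = 0)) ∧
      -- neighbours of a vertex of `C_i^+`
      (∀ i, i < d → ∀ z ∈ DelsarteClique.cellPlus G C x i,
        (∀ j, j + 1 = i →
          DelsarteClique.nbrs G z (DelsarteClique.cellMinus G C x j) = 0 ∧
          DelsarteClique.nbrs G z (DelsarteClique.cellPlus G C x j) = tc i) ∧
        (DelsarteClique.nbrs G z (DelsarteClique.cellMinus G C x i) : ℤ) =
          (DelsarteClique.cNum p (i + 1) : ℤ) - tc i ∧
        (DelsarteClique.nbrs G z (DelsarteClique.cellPlus G C x i) : ℤ) =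
          (ta i : ℤ) - DelsarteClique.cNum p (i + 1) + tc i ∧
        (DelsarteClique.nbrs G z (DelsarteClique.cellMinus G C x (i + 1)) : ℤ) =
          (tb i : ℤ) - DelsarteClique.bNum p (i + 1) ∧
        DelsarteClique.nbrs G z (DelsarteClique.cellPlus G C x (i + 1)) =
          DelsarteClique.bNum p (i + 1) ∧
        (∀ j, j + 1 ≠ i → j ≠ i → j ≠ i + 1 →
          DelsarteClique.nbrs G z (DelsarteClique.cellMinus G C x j) = 0 ∧
          DelsarteClique.nbrs G z (DelsarteClique.cellPlus G C x j) = 0)) := by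
  have hnt : Nontrivial V := SimpleGraph.nontrivial_of_diam_ne_zero (G := G) (by omega)
  have hdist : ∀ x y, G.dist x y ≤ d := fun x y =>
    hd ▸ SimpleGraph.dist_le_diam (SimpleGraph.ediam_ne_top_of_diam_ne_zero (by omega))
  obtain ⟨a, b, hab⟩ := G.exists_dist_eq_diam
  rw [hd] at hab
  obtain ⟨N, hN⟩ := hC.exists_near hG hdist hnt
  obtain ⟨ta, tb, tc, hL, htc⟩ := hC.exists_isLayerNumbers hG hdist hnt
  have hcard : 1 < C.card := by have := (hN x).2.2; omega
  have hpart := DelsarteClique.isPartition_cells hG hC.2.1 hcard hx (fun y => (hN y).1) hab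
  have htc' : ∀ j, j + 1 < d → 0 < tc (j + 1) := fun j hj => by
    obtain ⟨y, hy⟩ := hpart.nonempty (⟨j + 1, hj⟩, false)
    have h1 : DelsarteClique.distTo G C y = j + 1 := (DelsarteClique.mem_cellMinus.1 hy).1
    exact h1 ▸ htc y (by omega)
  have hc' : ∀ j, j + 1 < d → 0 < DelsarteClique.cNum p (j + 1) := fun j hj => by
    obtain ⟨y, hy⟩ := hpart.nonempty (⟨j + 1, hj⟩, false)
    exact DelsarteClique.cNum_pos hG (DelsarteClique.mem_cellMinus.1 hy).2
  exact ⟨⟨hpart, fun s t u hu v hv => DelsarteClique.equitable_cells hG hC.2.1 hx hL s t hu hv⟩, ta, tb, tc, hL,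
    fun i hi => ⟨DelsarteClique.card_cellMinus hG hC.2.1 hx hL hc' hi, DelsarteClique.card_cellPlus hG hC.2.1 hx hL htc' hi⟩,
    fun i hi z hz => DelsarteClique.nbrs_of_mem_cellMinus hG hC.2.1 hx hL hi hz,
    fun i hi z hz => DelsarteClique.nbrs_of_mem_cellPlus hG hC.2.1 hx hL hi hz⟩
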